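/- Let $r\ge 0$, and for $1\le i\le r$ let $M_i$ be a smooth Riemannian manifold of dimension $n_i\ge 2$ (without boundary) and $f_i\colon M_i\to\mathbb R^{m_i}$ a smooth isometric immersion. Let $M=M_1\times\cdots\times M_r$ carry the Riemannian product metric, let $\mathbb R^m=\mathbb R^{m_1}\oplus\cdots\oplus\mathbb R^{m_r}$ (orthogonal sum), and let $f\colon M\to\mathbb R^m$, $f(x)=(f_1(x_1),\dots,f_r(x_r))$, be the extrinsic product of the $f_i$. Write $\nabla$ for the Levi-Civita connection of $M$, $\tilde\nabla$ for that of Euclidean space, $N_fM(x)=(f_*T_xM)^\perp$ for the normal spaces and $\alpha(X,Y)=(\tilde\nabla_Xf_*Y)_{N_fM}$ for the second fundamental form of $f$. Assume that $f$ has full first normal spaces, i.e. $\operatorname{span}\{\alpha(X,Y):X,Y\in T_xM\}=N_fM(x)$ for every $x\in M$. An infinitesimal bending of an isometric immersion $h\colon N\to\mathbb R^k$ is a smooth section $\mathcal S$ of $h^*T\mathbb R^k$ (that is, a smooth map $N\to\mathbb R^k$) with $\langle\tilde\nabla_X\mathcal S,h_*Y\rangle+\langle h_*X,\tilde\nabla_Y\mathcal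 S\rangle=0$ for all tangent vectors $X,Y$ at the same point; it is trivial if $\mathcal S=\mathcal D h+v$ for a skew-symmetric endomorphism $\mathcal D$ of $\mathbb R^k$ and a vector $v\in\mathbb R^k$. Let $\mathcal T$ be an infinitesimal bending of $f$, and let $\beta(X,Y)=\bigl(\tilde\nabla_X\tilde\nabla_Y\mathcal T-\tilde\nabla_{\nabla_XY}\mathcal T\bigr)_{N_fM}$ be its associated tensor. Assume that $\beta$ is adapted to the product structure: $\beta(X,Y)=0$ at every point of $M$ whenever $X$ is tangent to the factor $M_i$ and $Y$ is tangent to the factor $M_j$ with $i\ne j$. Then $\mathcal T$ is locally a sum of infinitesimal bendings of the factors, up to a trivial one: every point $x^0\in M$ has a neighbourhood $U_1\times\cdots\times U_r$, with $U_i\subset M_i$ open, on which there are infinitesimal bendings $\mathcal T_i\colon U_i\to\mathbb R^{m_i}$ of $f_i|_{U_i}$, a skew-symmetric endomorphism $\mathcal D$ of $\mathbb R^m$ and a vector $v\in\mathbb R^m$ such that $$\mathcal T(x)=(\mathcal T_1(x_1),\dots,\mathcal T_r(x_r))+\mathcal D f(x)+v\qquad\text{for all }x\in U_1\times\cdots\times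 U_r .$$ -/

import Mathlib

open Set Bundle
open scoped Manifold ContDiff InnerProductSpace

noncomputable section

namespace InfBending

section General

variable {E : Type*} [NormedAddCommGroup E] [NormedSpace ℝ E]
  {H : Type*} [TopologicalSpace H] (I : ModelWithCorners ℝ E H)
  {M : Type*} [TopologicalSpace M] [ChartedSpace H M]
  {V : Type*} [NormedAddCommGroup V] [InnerProductSpace ℝ V] [FiniteDimensional ℝ V]

/-- The differential `u_* : T_x M → V` of a map `u : M → V` into a Euclidean space. For a section
`𝓣` of `f^*TV`, viewed as a map `M → V`, this is `X ↦ ∇̃_X 𝓣`. -/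
def diff (u : M → V) (x : M) : E →L[ℝ] V := mfderiv I 𝓘(ℝ, V) u x

/-- `f` is a smooth isometric immersion of `M`, with Riemannian metric `g`, into `V`. -/
structure IsIsometricImmersion (g : ∀ x : M, TangentSpace I x → TangentSpace I x → ℝ)
    (f : M → V) : Prop where
  smooth : ContMDiff I 𝓘(ℝ, V) ∞ f
  isometric : ∀ (x : M) (X Y : TangentSpace I x),
    ⟪diff I f x X, diff I f x Y⟫_ℝ = g x X Y

/-- `T` is a (smooth) infinitesimal bending of the restriction of `f` to the open set `U`. -/
structure IsInfinitesimalBendingOn (f T : M → V) (U : Set M) : Prop where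
  isOpen : IsOpen U
  smooth : ContMDiffOn I 𝓘(ℝ, V) ∞ T U
  bending : ∀ x ∈ U, ∀ X Y : TangentSpace I x,
    ⟪diff I T x X, diff I f x Y⟫_ℝ + ⟪diff I f x X, diff I T x Y⟫_ℝ = 0

/-- `T` is a trivial infinitesimal bending of `f` on `U`: the restriction along `f` of a Killing
field `y ↦ D y + v` of the ambient Euclidean space, with `D` skew-symmetric. -/
def IsTrivialBendingOn (f T : M → V) (U : Set M) : Prop :=
  ∃ (D : V →ₗ[ℝ] V) (v : V), (∀ y z : V, ⟪D y, z⟫_ℝ = -⟪y, D z⟫_ℝ) ∧ ∀ x ∈ U, T x = D (f x) + v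

/-- The coefficients `g_{ab}(y) = g(∂_a, ∂_b)` of the metric `g` in the chart at `x`; here `y` is a
point of the target of that chart, and `a`, `b` are constant coordinate vector fields. -/
def chartMetric (g : ∀ x : M, TangentSpace I x → TangentSpace I x → ℝ) (x : M) (y a b : E) : ℝ :=
  g ((extChartAt I x).symm y)
    (mfderiv 𝓘(ℝ, E) I (extChartAt I x).symm y a)
    (mfderiv 𝓘(ℝ, E) I (extChartAt I x).symm y b)

/-- The derivative `∂_a g_{bc}` at `x` of the metric coefficients in the chart at `x`. -/
def chartMetricDeriv (g : ∀ x : M, TangentSpace I x → TangentSpace I x → ℝ) (x : M)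
    (a b c : E) : ℝ :=
  fderiv ℝ (fun y => chartMetric I g x y b c) (extChartAt I x x) a

/-- The Christoffel symbol of the Levi-Civita connection of `g` at `x`, in the chart at `x`:
`Γ(a, b) = ∇_{∂_a} ∂_b` is the unique vector with
`g(Γ(a, b), c) = (∂_a g_{bc} + ∂_b g_{ac} - ∂_c g_{ab}) / 2` for all `c`. -/
def christoffel (g : ∀ x : M, TangentSpace I x → TangentSpace I x → ℝ) (x : M) (a b : E) : E :=
  Classical.epsilon fun w : E => ∀ c : E,
    chartMetric I g x (extChartAt I x x) w c =
      (chartMetricDeriv I g x a b c + chartMetricDeriv I g x b a c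
        - chartMetricDeriv I g x c a b) / 2

/-- The Hessian of a map `u : M → V` with respect to the Levi-Civita connection `∇` of `g`,
`(X, Y) ↦ ∇̃_X (u_* Y) - u_* ∇_X Y`, written in the chart at `x`: it is
`∂_a ∂_b u - u_* Γ(a, b)`. (The tangent space `T_x M` is identified with `E` through the chart
at `x`, and the tensor is evaluated on the extensions of `X`, `Y` by constant coordinate vector
fields.) For `u = 𝓣` this is the tensor `B(X, Y) = (∇̃_X L) Y` with `L X = ∇̃_X 𝓣`. -/
def hessian (g : ∀ x : M, TangentSpace I x → TangentSpace I x → ℝ) (u : M → V) (x : M)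
    (X Y : TangentSpace I x) : V :=
  fderiv ℝ (fun y : E => fderiv ℝ (u ∘ (extChartAt I x).symm) y) (extChartAt I x x) X Y
    - diff I u x (christoffel I g x X Y)

/-- The normal space `N_f M(x)`, the orthogonal complement of `f_* T_x M`. -/
def normalSpace (f : M → V) (x : M) : Submodule ℝ V := (diff I f x).rangeᗮ

/-- The second fundamental form `α` of `f`: the normal component of `∇̃_X f_* Y`, or equivalently
of `∇̃_X f_* Y - f_* ∇_X Y`. -/
def secondFundamentalForm (g : ∀ x : M, TangentSpace I x → TangentSpace I x → ℝ) (f : M → V)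
    (x : M) (X Y : TangentSpace I x) : V :=
  (normalSpace I f x).starProjection (hessian I g f x X Y)

/-- `f` has full first normal space at `x`: the vectors `α(X, Y)` span the normal space. -/
def HasFullFirstNormalSpace (g : ∀ x : M, TangentSpace I x → TangentSpace I x → ℝ) (f : M → V)
    (x : M) : Prop :=
  Submodule.span ℝ {w : V | ∃ X Y : TangentSpace I x, w = secondFundamentalForm I g f x X Y} =
    normalSpace I f x

/-- The tensor `β` associated to an infinitesimal bending `T` of `f`: the normal component of
`B(X, Y) = ∇̃_X (L Y) - L ∇_X Y`, where `L X = ∇̃_X T`. -/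
def bendingTensor (g : ∀ x : M, TangentSpace I x → TangentSpace I x → ℝ) (f T : M → V)
    (x : M) (X Y : TangentSpace I x) : V :=
  (normalSpace I f x).starProjection (hessian I g T x X Y)

end General

section Product

variable {r : ℕ} {n m : Fin r → ℕ}
  {M : Fin r → Type*} [∀ i, TopologicalSpace (M i)]
  [∀ i, ChartedSpace (EuclideanSpace ℝ (Fin (n i))) (M i)]

/-- The model with corners of a product manifold `M_1 × ⋯ × M_r` with `dim M_i = n_i`. -/
abbrev prodModel (n : Fin r → ℕ) :
    ModelWithCorners ℝ (∀ i, EuclideanSpace ℝ (Fin (n i)))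
      (ModelPi fun i => EuclideanSpace ℝ (Fin (n i))) :=
  ModelWithCorners.pi fun i => 𝓡 (n i)

/-- The Euclidean space `ℝ^m = ℝ^{m_1} ⊕ ⋯ ⊕ ℝ^{m_r}` (orthogonal direct sum). -/
abbrev Ambient (m : Fin r → ℕ) : Type := PiLp 2 fun i => EuclideanSpace ℝ (Fin (m i))

/-- The tangent vector `ι_{i*} X` of `M_1 × ⋯ × M_r` at `x`, for `X` tangent to `M_i` at `x_i`. -/
def inclTangent (x : ∀ i, M i) (i : Fin r) (X : TangentSpace (𝓡 (n i)) (x i)) :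
    TangentSpace (prodModel n) x :=
  (Pi.single i X : ∀ k, EuclideanSpace ℝ (Fin (n k)))

/-- The Riemannian product metric on `M_1 × ⋯ × M_r`. -/
def prodMetric [∀ i, IsManifold (𝓡 (n i)) ∞ (M i)]
    (g : ∀ i, ContMDiffRiemannianMetric (𝓡 (n i)) ∞ (EuclideanSpace ℝ (Fin (n i)))
      (fun x : M i => TangentSpace (𝓡 (n i)) x))
    (x : ∀ i, M i) (X Y : TangentSpace (prodModel n) x) : ℝ :=
  ∑ i, (g i).inner (x i) ((X : ∀ k, EuclideanSpace ℝ (Fin (n k))) i)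
    ((Y : ∀ k, EuclideanSpace ℝ (Fin (n k))) i)

/-- The extrinsic product `f(x) = (f_1(x_1), …, f_r(x_r))`. -/
def extrinsicProduct (f : ∀ i, M i → EuclideanSpace ℝ (Fin (m i))) (x : ∀ i, M i) : Ambient m :=
  WithLp.toLp 2 fun i => f i (x i)

/-- The tensor `β` of a bending `T` of `f : M_1 × ⋯ × M_r → V` is adapted to the product
structure: `β(ι_{i*} X, ι_{j*} Y) = 0` for `i ≠ j`. -/
def IsAdapted {V : Type*} [NormedAddCommGroup V] [InnerProductSpace ℝ V] [FiniteDimensional ℝ V]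
    (g : ∀ x : (∀ i, M i), TangentSpace (prodModel n) x → TangentSpace (prodModel n) x → ℝ)
    (f T : (∀ i, M i) → V) : Prop :=
  ∀ (x : ∀ i, M i) (i j : Fin r), i ≠ j →
    ∀ (X : TangentSpace (𝓡 (n i)) (x i)) (Y : TangentSpace (𝓡 (n j)) (x j)),
      bendingTensor (prodModel n) g f T x (inclTangent x i X) (inclTangent x j Y) = 0

end Product

end InfBending

end

/-! In a product chart the mixed second derivatives of `f` vanish, and so do the mixed Christoffel
symbols of the product metric. Let `w = ∂_a ∂_b T` with `a`, `b` in different factors. Adaptedness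
of `β` then says that `w` is tangent to `f`, while the differentiated bending equation `⟪∂_a ∂_b T,
∂_c f⟫ = -⟪∂_c T, ∂_a ∂_b f⟫ = 0` says that `w` is orthogonal to every tangent vector. Hence `w = 0`
(`fderiv_fderiv_bending_mixed`).

On a convex coordinate box `T` is therefore a sum of functions of the single variables
(`eq_sum_of_mixed`). The `i`-th component of the `i`-th summand is a bending of `f_i`. Write `T_ij`
for the `j`-th component of the `i`-th summand and `F_i` for `f_i` in coordinates, both normalised
to vanish at the base point. For `i ≠ j` the cross terms of the bending equation integrate to
`⟪T_ij(p), F_j(q)⟫ + ⟪F_i(p), T_ji(q)⟫ = 0`.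

Full first normal spaces keep each `f_i` from lying locally in a hyperplane
(`eq_zero_of_forall_inner_sub_eq_zero`), so the values of `F_j` span. The relation then forces `T_ij
= D_ij F_i` with `D_ij` linear and `D_ji` minus the adjoint of `D_ij`. The blocks `D_ij`, with zero
diagonal, form the skew endomorphism of the trivial part (`exists_bending_decomposition`). -/

noncomputable section

namespace InfBending

/-! ### Second-order consequences of the bending equation in coordinates. -/

section Flat

variable {E : Type*} [NormedAddCommGroup E] [NormedSpace ℝ E]
  {V : Type*} [NormedAddCommGroup V] [InnerProductSpace ℝ V]

lemma differentiableAt_fderiv_apply {u : E → V} {y : E} (hu : ContDiffAt ℝ 2 u y) :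
    DifferentiableAt ℝ (fderiv ℝ u) y :=
  (hu.fderiv_right (m := 1) (by norm_num)).differentiableAt (by norm_num)

lemma fderiv_fderiv_apply {u : E → V} {y : E} (hu : ContDiffAt ℝ 2 u y) (a b : E) :
    fderiv ℝ (fun z => fderiv ℝ u z b) y a = fderiv ℝ (fderiv ℝ u) y a b := by
  rw [fderiv_clm_apply (differentiableAt_fderiv_apply hu) (differentiableAt_const b)]
  simp

/-- The Hessian of a bending: `⟪∂ₐ∂_b T, ∂_c F⟫ = -⟪∂_c T, ∂ₐ∂_b F⟫`. -/
lemma inner_fderiv_fderiv_add_eq_zero {T F : E → V} {y : E} (hT : ContDiffAt ℝ 2 T y)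
    (hF : ContDiffAt ℝ 2 F y)
    (h : ∀ᶠ z in nhds y, ∀ a b : E,
      ⟪fderiv ℝ T z a, fderiv ℝ F z b⟫_ℝ + ⟪fderiv ℝ F z a, fderiv ℝ T z b⟫_ℝ = 0) (a b c : E) :
    ⟪fderiv ℝ (fderiv ℝ T) y a b, fderiv ℝ F y c⟫_ℝ
      + ⟪fderiv ℝ T y c, fderiv ℝ (fderiv ℝ F) y a b⟫_ℝ = 0 := by
  have sT : ∀ a b, fderiv ℝ (fderiv ℝ T) y a b = fderiv ℝ (fderiv ℝ T) y b a := fun a b =>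
    (hT.isSymmSndFDerivAt (by simp)).eq a b
  have sF : ∀ a b, fderiv ℝ (fderiv ℝ F) y a b = fderiv ℝ (fderiv ℝ F) y b a := fun a b =>
    (hF.isSymmSndFDerivAt (by simp)).eq a b
  have dT := differentiableAt_fderiv_apply hT
  have dF := differentiableAt_fderiv_apply hF
  -- The bending equation differentiated once. With `P(ab, c) = ⟪T_ab, F_c⟫ + ⟪T_c, F_ab⟫`, which is
  -- symmetric in `a`, `b`, it reads `P(ab, c) + P(ac, b) = 0`.
  have key : ∀ a b c : E,
      ⟪fderiv ℝ T y b, fderiv ℝ (fderiv ℝ F) y a c⟫_ℝ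
        + ⟪fderiv ℝ (fderiv ℝ T) y a b, fderiv ℝ F y c⟫_ℝ
        + (⟪fderiv ℝ F y b, fderiv ℝ (fderiv ℝ T) y a c⟫_ℝ
        + ⟪fderiv ℝ (fderiv ℝ F) y a b, fderiv ℝ T y c⟫_ℝ) = 0 := by
    intro a b c
    have dTv : ∀ b, DifferentiableAt ℝ (fun z => fderiv ℝ T z b) y := fun b =>
      dT.clm_apply (differentiableAt_const b)
    have dFv : ∀ b, DifferentiableAt ℝ (fun z => fderiv ℝ F z b) y := fun b =>
      dF.clm_apply (differentiableAt_const b)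
    have h0 : (fun z => ⟪fderiv ℝ T z b, fderiv ℝ F z c⟫_ℝ + ⟪fderiv ℝ F z b, fderiv ℝ T z c⟫_ℝ)
        =ᶠ[nhds y] fun _ => (0 : ℝ) := by
      filter_upwards [h] with z hz using hz b c
    have h1 := h0.fderiv_eq (𝕜 := ℝ)
    rw [fderiv_fun_add ((dTv b).inner ℝ (dFv c)) ((dFv b).inner ℝ (dTv c))] at h1
    have h2 := congrArg (fun L : E →L[ℝ] ℝ => L a) h1
    simpa [fderiv_inner_apply ℝ (dTv b) (dFv c), fderiv_inner_apply ℝ (dFv b) (dTv c),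
      fderiv_fderiv_apply hT, fderiv_fderiv_apply hF] using h2
  -- As in the Koszul formula, the combination `k1 + k2 - k3` of the cyclic permutations leaves `2
  -- P(ab, c) = 0`.
  have k1 := key a b c
  have k2 := key b c a
  have k3 := key c a b
  rw [sT b c, sT b a, sF b c, sF b a] at k2
  rw [sT c a, sF c a, sT c b, sF c b] at k3
  rw [sT c b, sF c b] at k2
  rw [sT b c, sF b c] at *
  simp only [real_inner_comm] at *
  linarith

/-- If `⟪w, F⟫` is locally constant, then `w` is orthogonal to the first and second derivatives
of `F`. -/
lemma inner_derivs_eq_zero {F : E → V} {y : E} (hF : ContDiffAt ℝ 2 F y) {w : V} {c : ℝ}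
    (h : ∀ᶠ z in nhds y, ⟪w, F z⟫_ℝ = c) :
    (∀ a, ⟪w, fderiv ℝ F y a⟫_ℝ = 0) ∧ ∀ a b, ⟪w, fderiv ℝ (fderiv ℝ F) y a b⟫_ℝ = 0 := by
  have hd : ∀ᶠ z in nhds y, DifferentiableAt ℝ F z := by
    filter_upwards [hF.eventually (by simp)] with z hz using hz.differentiableAt (by norm_num)
  have h1 : ∀ᶠ z in nhds y, ∀ a, ⟪w, fderiv ℝ F z a⟫_ℝ = 0 := by
    filter_upwards [h.eventually_nhds, hd] with z hz hdz a
    have e : (fun x => ⟪w, F x⟫_ℝ) =ᶠ[nhds z] fun _ => c := hz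
    have := congrArg (fun L : E →L[ℝ] ℝ => L a) e.fderiv_eq
    simpa [fderiv_inner_apply ℝ (differentiableAt_const w) hdz] using this
  refine ⟨h1.self_of_nhds, fun a b => ?_⟩
  have e : (fun x => ⟪w, fderiv ℝ F x b⟫_ℝ) =ᶠ[nhds y] fun _ => (0 : ℝ) := by
    filter_upwards [h1] with z hz using hz b
  have := congrArg (fun L : E →L[ℝ] ℝ => L a) e.fderiv_eq
  simpa [fderiv_inner_apply ℝ (differentiableAt_const w)
    ((differentiableAt_fderiv_apply hF).clm_apply (differentiableAt_const b)),
    fderiv_fderiv_apply hF] using this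

end Flat

/-! ### Separation of variables on convex boxes. -/

section Separation

variable {ι : Type*} [Fintype ι] [DecidableEq ι] {E : ι → Type*}
  [∀ i, NormedAddCommGroup (E i)] [∀ i, NormedSpace ℝ (E i)]
  {V : Type*} [NormedAddCommGroup V] [InnerProductSpace ℝ V]

lemma hasFDerivAt_comp_update {T : (∀ i, E i) → V} {y : ∀ i, E i} {i : ι} {p : E i}
    (hT : DifferentiableAt ℝ T (Function.update y i p)) :
    HasFDerivAt (fun q => T (Function.update y i q))
      ((fderiv ℝ T (Function.update y i p)).comp (ContinuousLinearMap.single ℝ E i)) p := by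
  have := hasFDerivAt_update (𝕜 := ℝ) y (i := i) p
  refine (hT.hasFDerivAt.comp p this).congr_fderiv ?_
  ext v
  simp only [ContinuousLinearMap.comp_apply, ContinuousLinearMap.single_apply]
  congr 1
  ext k
  by_cases hk : k = i
  · subst hk; simp
  · simp [hk]

lemma eq_sum_pi_single {ι : Type*} [Fintype ι] [DecidableEq ι] {E : ι → Type*}
    [∀ i, AddCommGroup (E i)] (c : ∀ i, E i) : c = ∑ i, Pi.single i (c i) := by
  ext k; simp [Finset.sum_apply, Finset.sum_pi_single]

/-- If all mixed second derivatives of `T` vanish, `∂_i T` depends on the `i`-th variable only. -/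
lemma fderiv_single_eq_of_mixed {B : ∀ i, Set (E i)} (hB : ∀ i, IsOpen (B i))
    (hc : ∀ i, Convex ℝ (B i)) {T : (∀ i, E i) → V} (hT : ContDiffOn ℝ 2 T (univ.pi B))
    (hmix : ∀ y ∈ univ.pi B, ∀ i j, i ≠ j → ∀ (a : E i) (b : E j),
      fderiv ℝ (fderiv ℝ T) y (Pi.single i a) (Pi.single j b) = 0)
    {y z : ∀ i, E i} (hy : y ∈ univ.pi B) (hz : z ∈ univ.pi B) {i : ι} (hi : y i = z i) (a : E i) :
    fderiv ℝ T y (Pi.single i a) = fderiv ℝ T z (Pi.single i a) := by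
  have hO : IsOpen (univ.pi B) := isOpen_set_pi finite_univ fun i _ => hB i
  have hC : Convex ℝ (univ.pi B) := convex_pi fun i _ => hc i
  have hd : ∀ x ∈ univ.pi B, DifferentiableAt ℝ (fderiv ℝ T) x := fun x hx =>
    differentiableAt_fderiv_apply (hT.contDiffAt (hO.mem_nhds hx))
  let γ : ℝ → (∀ i, E i) := fun t => y + t • (z - y)
  have hγ : ∀ t ∈ Icc (0 : ℝ) 1, γ t ∈ univ.pi B := fun t ht =>
    hC.add_smul_sub_mem hy hz ht
  have hγd : ∀ t, HasDerivAt γ (z - y) t := fun t => by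
    simpa only [one_smul, id] using ((hasDerivAt_id t).smul_const (z - y)).const_add y
  -- The displacement `z - y` has no `i`-component, so only mixed derivatives occur, and `∂_i T` is
  -- constant along the segment from `y` to `z`.
  have hzero : ∀ x ∈ univ.pi B, fderiv ℝ (fderiv ℝ T) x (z - y) (Pi.single i a) = 0 := by
    intro x hx
    rw [eq_sum_pi_single (z - y), map_sum, sum_apply]
    refine Finset.sum_eq_zero fun k _ => ?_
    by_cases hk : k = i
    · subst hk; simp [hi]
    · exact hmix x hx k i hk _ _
  have hder : ∀ t ∈ Icc (0 : ℝ) 1,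
      HasDerivAt (fun t => fderiv ℝ T (γ t) (Pi.single i a)) 0 t := by
    intro t ht
    have h1 := ((hd _ (hγ t ht)).hasFDerivAt.comp_hasDerivAt t (hγd t)).clm_apply
      (hasDerivAt_const t (Pi.single i a))
    refine h1.congr_deriv ?_
    rw [hzero _ (hγ t ht), map_zero, add_zero]
  have := constant_of_has_deriv_right_zero
    (fun t ht => (hder t ht).continuousAt.continuousWithinAt)
    (fun t ht => (hder t (Ico_subset_Icc_self ht)).hasDerivWithinAt) 1 (by simp)
  simpa [γ] using this.symm

/-- A map on a convex box with vanishing mixed second derivatives is a sum of functions of the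
single variables. -/
lemma eq_sum_of_mixed {B : ∀ i, Set (E i)} (hB : ∀ i, IsOpen (B i))
    (hc : ∀ i, Convex ℝ (B i)) {T : (∀ i, E i) → V} (hT : ContDiffOn ℝ 2 T (univ.pi B))
    (hmix : ∀ y ∈ univ.pi B, ∀ i j, i ≠ j → ∀ (a : E i) (b : E j),
      fderiv ℝ (fderiv ℝ T) y (Pi.single i a) (Pi.single j b) = 0)
    {y₀ y : ∀ i, E i} (hy₀ : y₀ ∈ univ.pi B) (hy : y ∈ univ.pi B) :
    T y - T y₀ = ∑ i, (T (Function.update y₀ i (y i)) - T y₀) := by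
  have hO : IsOpen (univ.pi B) := isOpen_set_pi finite_univ fun i _ => hB i
  have hC : Convex ℝ (univ.pi B) := convex_pi fun i _ => hc i
  have hd : ∀ x ∈ univ.pi B, DifferentiableAt ℝ T x := fun x hx =>
    (hT.contDiffAt (hO.mem_nhds hx)).differentiableAt (by norm_num)
  have hup : ∀ x ∈ univ.pi B, ∀ i, Function.update y₀ i (x i) ∈ univ.pi B := by
    intro x hx i
    rw [update_mem_pi_iff_of_mem hy₀]
    exact fun _ => hx i trivial
  -- The remainder has zero derivative: each partial of `T` at `x` equals the one at the projection
  -- of `x` to the axis through `y₀`.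
  let R : (∀ i, E i) → V := fun x => T x - ∑ i, (T (Function.update y₀ i (x i)) - T y₀)
  have hR : ∀ x ∈ univ.pi B, HasFDerivAt R (0 : (∀ i, E i) →L[ℝ] V) x := by
    intro x hx
    have h1 : ∀ i, HasFDerivAt (fun x : ∀ i, E i => T (Function.update y₀ i (x i)) - T y₀)
        (((fderiv ℝ T (Function.update y₀ i (x i))).comp
          (ContinuousLinearMap.single ℝ E i)).comp (ContinuousLinearMap.proj i)) x := fun i =>
      (HasFDerivAt.comp (g := fun q => T (Function.update y₀ i q)) (f := fun x : ∀ i, E i => x i) x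
        (hasFDerivAt_comp_update (hd _ (hup x hx i))) (hasFDerivAt_apply i x)).sub_const _
    refine ((hd x hx).hasFDerivAt.sub (HasFDerivAt.fun_sum fun i _ => h1 i)).congr_fderiv ?_
    ext c
    simp only [sub_apply, sum_apply,
      ContinuousLinearMap.comp_apply, zero_apply, sub_eq_zero]
    conv_lhs => rw [eq_sum_pi_single c, map_sum]
    refine Finset.sum_congr rfl fun i _ => ?_
    exact fderiv_single_eq_of_mixed hB hc hT hmix hx (hup x hx i) (by simp) _
  have hconst : R y = R y₀ := by
    refine hC.is_const_of_fderivWithin_eq_zero (𝕜 := ℝ)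
      (fun x hx => (hR x hx).differentiableAt.differentiableWithinAt) (fun x hx => ?_) hy hy₀
    rw [fderivWithin_of_isOpen hO hx, (hR x hx).fderiv]
  simp only [R, Function.update_eq_self, sub_self, Finset.sum_const_zero, sub_zero] at hconst
  rw [sub_eq_iff_eq_add, add_comm, ← sub_eq_iff_eq_add, hconst]

end Separation

/-! ### Integrating the cross terms and extracting linear maps. -/

section CrossTerms

variable {E₁ E₂ W₁ W₂ : Type*} [NormedAddCommGroup E₁] [NormedSpace ℝ E₁]
  [NormedAddCommGroup E₂] [NormedSpace ℝ E₂]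
  [NormedAddCommGroup W₁] [InnerProductSpace ℝ W₁] [NormedAddCommGroup W₂] [InnerProductSpace ℝ W₂]

/-- Integration in one variable against fixed vectors `u`, `w`; it is applied once in each variable
of the cross-term identity. -/
lemma inner_sub_eq_zero_of_fderiv {B : Set E₁} (hB : IsOpen B) (hc : Convex ℝ B)
    {S : E₁ → W₂} {F : E₁ → W₁} (hS : ∀ p ∈ B, DifferentiableAt ℝ S p)
    (hF : ∀ p ∈ B, DifferentiableAt ℝ F p) {u : W₂} {w : W₁}
    (h : ∀ p ∈ B, ∀ a, ⟪fderiv ℝ S p a, u⟫_ℝ + ⟪fderiv ℝ F p a, w⟫_ℝ = 0)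
    {p₀ p : E₁} (hp₀ : p₀ ∈ B) (hp : p ∈ B) :
    ⟪S p - S p₀, u⟫_ℝ + ⟪F p - F p₀, w⟫_ℝ = 0 := by
  have hd : ∀ p ∈ B, HasFDerivAt (fun p => ⟪S p, u⟫_ℝ + ⟪F p, w⟫_ℝ) (0 : E₁ →L[ℝ] ℝ) p := by
    intro p hp
    refine (((hS p hp).hasFDerivAt.inner ℝ (hasFDerivAt_const u p)).add
      ((hF p hp).hasFDerivAt.inner ℝ (hasFDerivAt_const w p))).congr_fderiv ?_
    ext a
    simpa using h p hp a
  have := hc.is_const_of_fderivWithin_eq_zero (𝕜 := ℝ)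
      (fun x hx => (hd x hx).differentiableAt.differentiableWithinAt)
      (fun x hx => by rw [fderivWithin_of_isOpen hB hx, (hd x hx).fderiv]) hp hp₀
  simp only [inner_sub_left]
  linarith

/-- Integration of the cross terms of the bending equation in both variables. -/
lemma inner_sub_add_inner_sub_eq_zero {B₁ : Set E₁} {B₂ : Set E₂} (hB₁ : IsOpen B₁)
    (hB₂ : IsOpen B₂) (hc₁ : Convex ℝ B₁) (hc₂ : Convex ℝ B₂)
    {S₁ : E₁ → W₂} {F₁ : E₁ → W₁} {S₂ : E₂ → W₁} {F₂ : E₂ → W₂}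
    (hS₁ : ∀ p ∈ B₁, DifferentiableAt ℝ S₁ p) (hF₁ : ∀ p ∈ B₁, DifferentiableAt ℝ F₁ p)
    (hS₂ : ∀ p ∈ B₂, DifferentiableAt ℝ S₂ p) (hF₂ : ∀ p ∈ B₂, DifferentiableAt ℝ F₂ p)
    (h : ∀ p ∈ B₁, ∀ q ∈ B₂, ∀ a b,
      ⟪fderiv ℝ S₁ p a, fderiv ℝ F₂ q b⟫_ℝ + ⟪fderiv ℝ F₁ p a, fderiv ℝ S₂ q b⟫_ℝ = 0)
    {p₀ p : E₁} {q₀ q : E₂} (hp₀ : p₀ ∈ B₁) (hp : p ∈ B₁) (hq₀ : q₀ ∈ B₂) (hq : q ∈ B₂) :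
    ⟪S₁ p - S₁ p₀, F₂ q - F₂ q₀⟫_ℝ + ⟪F₁ p - F₁ p₀, S₂ q - S₂ q₀⟫_ℝ = 0 := by
  -- The outer integration is in `p`, against the increments of `F₂` and `S₂`. Its hypothesis is the
  -- integral in `q` against the fixed vectors `∂_a S₁`, `∂_a F₁`, so `F₂` and `S₂` exchange places
  -- there.
  refine inner_sub_eq_zero_of_fderiv hB₁ hc₁ hS₁ hF₁ (fun p hp a => ?_) hp₀ hp
  have := inner_sub_eq_zero_of_fderiv hB₂ hc₂ hF₂ hS₂ (u := fderiv ℝ S₁ p a)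
    (w := fderiv ℝ F₁ p a) (fun q hq b => ?_) hq₀ hq
  · rwa [real_inner_comm, real_inner_comm (fderiv ℝ F₁ p a)] at this
  · rw [real_inner_comm, real_inner_comm (fderiv ℝ F₁ p a)]
    exact h p hp q hq a b

/-- A family of vectors which pairs with a spanning family through the vectors `x k` depends
linearly on `x k`. -/
lemma exists_linearMap_of_inner_eq [FiniteDimensional ℝ W₁] [FiniteDimensional ℝ W₂]
    {κ₁ κ₂ : Type*} {x : κ₁ → W₁} {y : κ₁ → W₂} {u : κ₂ → W₁} {z : κ₂ → W₂}
    (hz : Submodule.span ℝ (range z) = ⊤)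
    (h : ∀ k l, ⟪y k, z l⟫_ℝ + ⟪x k, u l⟫_ℝ = 0) :
    ∃ D : W₁ →ₗ[ℝ] W₂, ∀ k, y k = D (x k) := by
  have hsurj : LinearMap.range (Finsupp.linearCombination ℝ z) = ⊤ := by
    rw [Finsupp.range_linearCombination, hz]
  obtain ⟨σ, hσ⟩ := (Finsupp.linearCombination ℝ z).exists_rightInverse_of_surjective hsurj
  -- Any linear section `σ` of the spanning map will do: expanding `w` in the `z l` turns the
  -- relation into `⟪y k, w⟫ = -⟪x k, u(σ w)⟫`, so `y k` is the adjoint of `w ↦ -u(σ w)` applied to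
  -- `x k`.
  refine ⟨LinearMap.adjoint (-(Finsupp.linearCombination ℝ u ∘ₗ σ)), fun k => ?_⟩
  have hlin : ∀ c : κ₂ →₀ ℝ, ⟪y k, Finsupp.linearCombination ℝ z c⟫_ℝ
      + ⟪x k, Finsupp.linearCombination ℝ u c⟫_ℝ = 0 := by
    intro c
    simp only [Finsupp.linearCombination_apply, Finsupp.sum, inner_sum, inner_smul_right]
    rw [← Finset.sum_add_distrib]
    exact Finset.sum_eq_zero fun l _ => by rw [← mul_add, h, mul_zero]
  refine ext_inner_right ℝ fun w => ?_
  rw [LinearMap.adjoint_inner_left]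
  have h1 := hlin (σ w)
  have h2 : Finsupp.linearCombination ℝ z (σ w) = w := LinearMap.congr_fun hσ w
  rw [h2] at h1
  simp only [LinearMap.neg_apply, LinearMap.comp_apply, inner_neg_right]
  linarith

end CrossTerms

/-! ### The decomposition theorem on a coordinate box. -/

section Decomposition

lemma inner_piLp_single_left {ι : Type*} [Fintype ι] [DecidableEq ι] {W : ι → Type*}
    [∀ i, NormedAddCommGroup (W i)] [∀ i, InnerProductSpace ℝ (W i)] (i : ι) (w : W i)
    (z : PiLp 2 W) : ⟪PiLp.single 2 i w, z⟫_ℝ = ⟪w, z i⟫_ℝ := by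
  rw [PiLp.inner_apply, Finset.sum_eq_single i]
  · simp
  · intro k _ hk
    simp [hk]
  · simp

variable {ι : Type*} [Fintype ι] {E W : ι → Type*}
  [∀ i, NormedAddCommGroup (E i)] [∀ i, NormedSpace ℝ (E i)]
  [∀ i, NormedAddCommGroup (W i)] [∀ i, InnerProductSpace ℝ (W i)]

lemma hasFDerivAt_toLp_pi {F : ∀ i, E i → W i} {y : ∀ i, E i}
    (hF : ∀ i, DifferentiableAt ℝ (F i) (y i)) :
    HasFDerivAt (fun y : ∀ i, E i => (WithLp.toLp 2 fun i => F i (y i) : PiLp 2 W))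
      (((PiLp.continuousLinearEquiv 2 ℝ W).symm : (∀ i, W i) →L[ℝ] PiLp 2 W).comp
        (ContinuousLinearMap.pi fun i =>
          (fderiv ℝ (F i) (y i)).comp (ContinuousLinearMap.proj i))) y := by
  refine HasFDerivAt.comp y (g := (PiLp.continuousLinearEquiv 2 ℝ W).symm)
    (f := fun y i => F i (y i))
    (PiLp.continuousLinearEquiv 2 ℝ W).symm.hasFDerivAt ?_
  exact hasFDerivAt_pi.2 fun i =>
    HasFDerivAt.comp (f := fun y : ∀ i, E i => y i) y (hF i).hasFDerivAt (hasFDerivAt_apply i y)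

variable [DecidableEq ι]

lemma fderiv_toLp_pi_single {F : ∀ i, E i → W i} {y : ∀ i, E i}
    (hF : ∀ i, DifferentiableAt ℝ (F i) (y i)) (i : ι) (a : E i) :
    fderiv ℝ (fun y : ∀ i, E i => (WithLp.toLp 2 fun i => F i (y i) : PiLp 2 W)) y (Pi.single i a)
      = PiLp.single 2 i (fderiv ℝ (F i) (y i) a) := by
  rw [(hasFDerivAt_toLp_pi hF).fderiv]
  ext k
  by_cases hk : k = i
  · subst hk; simp
  · simp [hk]

lemma hasFDerivAt_component_update {T : (∀ i, E i) → PiLp 2 W} {y : ∀ i, E i} {i : ι} {p : E i}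
    (hT : DifferentiableAt ℝ T (Function.update y i p)) (j : ι) :
    HasFDerivAt (fun q => T (Function.update y i q) j)
      ((PiLp.proj 2 W j : PiLp 2 W →L[ℝ] W j).comp
        ((fderiv ℝ T (Function.update y i p)).comp (ContinuousLinearMap.single ℝ E i))) p :=
  HasFDerivAt.comp (g := (PiLp.proj 2 W j : PiLp 2 W →L[ℝ] W j)) p
    (PiLp.proj 2 W j : PiLp 2 W →L[ℝ] W j).hasFDerivAt (hasFDerivAt_comp_update hT)

variable [∀ i, FiniteDimensional ℝ (W i)]

/-- On a convex coordinate box, a bending of a product of substantial maps whose mixed second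
derivatives vanish is a sum of bendings of the factors and a trivial bending. -/
theorem exists_bending_decomposition {B : ∀ i, Set (E i)} (hB : ∀ i, IsOpen (B i))
    (hc : ∀ i, Convex ℝ (B i)) {F : ∀ i, E i → W i} (hF : ∀ i, ContDiffOn ℝ ∞ (F i) (B i))
    {T : (∀ i, E i) → PiLp 2 W} (hT : ContDiffOn ℝ ∞ T (univ.pi B))
    (hbend : ∀ y ∈ univ.pi B, ∀ a b : ∀ i, E i,
      ⟪fderiv ℝ T y a, fderiv ℝ (fun y : ∀ i, E i => (WithLp.toLp 2 fun i => F i (y i) : PiLp 2 W))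
        y b⟫_ℝ + ⟪fderiv ℝ (fun y : ∀ i, E i => (WithLp.toLp 2 fun i => F i (y i) : PiLp 2 W)) y a,
        fderiv ℝ T y b⟫_ℝ = 0)
    (hmix : ∀ y ∈ univ.pi B, ∀ i j, i ≠ j → ∀ (a : E i) (b : E j),
      fderiv ℝ (fderiv ℝ T) y (Pi.single i a) (Pi.single j b) = 0)
    {y₀ : ∀ i, E i} (hy₀ : y₀ ∈ univ.pi B)
    (hsub : ∀ i, ∀ w : W i, (∀ p ∈ B i, ⟪w, F i p - F i (y₀ i)⟫_ℝ = 0) → w = 0) :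
    ∃ S : ∀ i, E i → W i, (∀ i, ContDiffOn ℝ ∞ (S i) (B i)) ∧
      (∀ i, ∀ p ∈ B i, ∀ a b, ⟪fderiv ℝ (S i) p a, fderiv ℝ (F i) p b⟫_ℝ
        + ⟪fderiv ℝ (F i) p a, fderiv ℝ (S i) p b⟫_ℝ = 0) ∧
      ∃ (D : PiLp 2 W →ₗ[ℝ] PiLp 2 W) (v : PiLp 2 W), (∀ y z, ⟪D y, z⟫_ℝ = -⟪y, D z⟫_ℝ) ∧
        ∀ y ∈ univ.pi B, T y - ∑ i, PiLp.single 2 i (S i (y i))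
          = D (WithLp.toLp 2 fun i => F i (y i)) + v := by
  have hO : IsOpen (univ.pi B) := isOpen_set_pi finite_univ fun i _ => hB i
  have hT2 : ContDiffOn ℝ 2 T (univ.pi B) := hT.of_le (by norm_cast)
  have hd : ∀ x ∈ univ.pi B, DifferentiableAt ℝ T x := fun x hx =>
    (hT.contDiffAt (hO.mem_nhds hx)).differentiableAt (by simp)
  have hFd : ∀ i, ∀ p ∈ B i, DifferentiableAt ℝ (F i) p := fun i p hp =>
    ((hF i).contDiffAt ((hB i).mem_nhds hp)).differentiableAt (by simp)
  have hup : ∀ x ∈ univ.pi B, ∀ i, ∀ p ∈ B i, Function.update x i p ∈ univ.pi B := by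
    intro x hx i p hp
    rw [update_mem_pi_iff_of_mem hx]
    exact fun _ => hp
  have hSd : ∀ i j, ∀ p ∈ B i, HasFDerivAt (fun q => T (Function.update y₀ i q) j) _ p :=
    fun i j p hp => hasFDerivAt_component_update (hd _ (hup _ hy₀ i p hp)) j
  -- Since `∂_i T` depends on the `i`-th variable only, the restriction of `T` to the `i`-th axis
  -- through `y₀` carries the partial derivative at every point of the box.
  have hdir : ∀ i j, ∀ x ∈ univ.pi B, ∀ a,
      fderiv ℝ (fun q => T (Function.update y₀ i q) j) (x i) a
        = fderiv ℝ T x (Pi.single i a) j := by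
    intro i j x hx a
    rw [(hSd i j (x i) (hx i trivial)).fderiv]
    have := fderiv_single_eq_of_mixed hB hc hT2 hmix
      (hup _ hy₀ i (x i) (hx i trivial)) hx (i := i) (by simp) a
    simp [this]
  -- For `i = j` this is the bending equation of the `i`-th factor; for `i ≠ j` it is the cross
  -- relation to be integrated.
  have hcross : ∀ i j, ∀ x ∈ univ.pi B, ∀ a b,
      ⟪fderiv ℝ (fun q => T (Function.update y₀ i q) j) (x i) a, fderiv ℝ (F j) (x j) b⟫_ℝ
        + ⟪fderiv ℝ (F i) (x i) a, fderiv ℝ (fun q => T (Function.update y₀ j q) i) (x j) b⟫_ℝ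
          = 0 := by
    intro i j x hx a b
    have h := hbend x hx (Pi.single i a) (Pi.single j b)
    rw [fderiv_toLp_pi_single fun i => hFd i _ (hx i trivial),
      fderiv_toLp_pi_single fun i => hFd i _ (hx i trivial)] at h
    rw [hdir i j x hx, hdir j i x hx]
    rwa [inner_piLp_single_left, real_inner_comm, inner_piLp_single_left, real_inner_comm] at h
  have hrel : ∀ i j, i ≠ j → ∀ p ∈ B i, ∀ q ∈ B j,
      ⟪T (Function.update y₀ i p) j - T y₀ j, F j q - F j (y₀ j)⟫_ℝ
        + ⟪F i p - F i (y₀ i), T (Function.update y₀ j q) i - T y₀ i⟫_ℝ = 0 := by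
    intro i j hij p hp q hq
    have := inner_sub_add_inner_sub_eq_zero (hB i) (hB j) (hc i) (hc j)
      (S₁ := fun q => T (Function.update y₀ i q) j) (F₁ := F i)
      (S₂ := fun q => T (Function.update y₀ j q) i) (F₂ := F j)
      (fun p hp => (hSd i j p hp).differentiableAt) (hFd i)
      (fun p hp => (hSd j i p hp).differentiableAt) (hFd j)
      (fun p hp q hq a b => by
        have := hcross i j (Function.update (Function.update y₀ i p) j q)
          (hup _ (hup _ hy₀ i p hp) j q hq) a b
        simpa [hij] using this)
      (hy₀ i trivial) hp (hy₀ j trivial) hq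
    simpa using this
  have hspan : ∀ j, Submodule.span ℝ (range fun q : B j => F j q - F j (y₀ j)) = ⊤ := by
    intro j
    rw [← Submodule.orthogonal_eq_bot_iff, Submodule.eq_bot_iff]
    intro w hw
    refine hsub j w fun p hp => ?_
    rw [real_inner_comm]
    exact (Submodule.mem_orthogonal _ _).1 hw _ (Submodule.subset_span ⟨⟨p, hp⟩, rfl⟩)
  -- The diagonal blocks are set to zero because the diagonal part of `T` goes into the bendings of
  -- the factors.
  have hD : ∀ i j, ∃ D : W i →ₗ[ℝ] W j, (i = j → D = 0) ∧
      (i ≠ j → ∀ p ∈ B i, T (Function.update y₀ i p) j - T y₀ j = D (F i p - F i (y₀ i))) := by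
    intro i j
    by_cases hij : i = j
    · exact ⟨0, fun _ => rfl, fun h => absurd hij h⟩
    · obtain ⟨D, hD⟩ := exists_linearMap_of_inner_eq
        (x := fun p : B i => F i p - F i (y₀ i))
        (y := fun p : B i => T (Function.update y₀ i p) j - T y₀ j)
        (u := fun q : B j => T (Function.update y₀ j q) i - T y₀ i)
        (hspan j) (fun p q => hrel i j hij p p.2 q q.2)
      exact ⟨D, fun h => absurd h hij, fun _ p hp => hD ⟨p, hp⟩⟩
  choose D hD0 hD1 using hD
  -- On increments of `F i` and `F j` this is `hrel`; both families span, so bilinearity gives the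
  -- rest.
  have hskew : ∀ i j (w : W i) (z : W j), ⟪D i j w, z⟫_ℝ + ⟪w, D j i z⟫_ℝ = 0 := by
    intro i j w z
    by_cases hij : i = j
    · simp [hD0 i j hij, hD0 j i hij.symm]
    have hw : w ∈ Submodule.span ℝ (range fun q : B i => F i q - F i (y₀ i)) := by
      rw [hspan]; trivial
    have hz : z ∈ Submodule.span ℝ (range fun q : B j => F j q - F j (y₀ j)) := by
      rw [hspan]; trivial
    induction hw, hz using Submodule.span_induction₂ with
    | mem_mem x y hx hy =>
      obtain ⟨p, rfl⟩ := hx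
      obtain ⟨q, rfl⟩ := hy
      simpa only [← hD1 i j hij p p.2, ← hD1 j i (Ne.symm hij) q q.2] using
        hrel i j hij p p.2 q q.2
    | zero_left y hy => simp
    | zero_right x hx => simp
    | add_left x y z _ _ _ h1 h2 => simp only [map_add, inner_add_left]; linarith
    | add_right x y z _ _ _ h1 h2 => simp only [map_add, inner_add_right]; linarith
    | smul_left r x y _ _ h1 =>
      simp only [map_smul, real_inner_smul_left]; rw [← mul_add, h1, mul_zero]
    | smul_right r x y _ _ h1 =>
      simp only [map_smul, real_inner_smul_right]; rw [← mul_add, h1, mul_zero]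
  let 𝓓 : PiLp 2 W →ₗ[ℝ] PiLp 2 W :=
    (PiLp.continuousLinearEquiv 2 ℝ W).symm.toLinearEquiv.toLinearMap ∘ₗ
      LinearMap.pi fun j => ∑ i, D i j ∘ₗ (PiLp.proj 2 W i : PiLp 2 W →L[ℝ] W i).toLinearMap
  have h𝓓 : ∀ w j, 𝓓 w j = ∑ i, D i j (w i) := by
    intro w j
    simp [𝓓]
  -- Each bending is the `i`-th component of `T` on the `i`-th axis. It keeps the constant `T y₀ i`,
  -- so the translation only has to undo the normalisation of `F` at `y₀`.
  refine ⟨fun i p => T (Function.update y₀ i p) i, fun i => ?_, fun i p hp a b => ?_, 𝓓,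
    -𝓓 (WithLp.toLp 2 fun i => F i (y₀ i)), fun y z => ?_, fun y hy => ?_⟩
  · have h1 : ContDiffOn ℝ ∞ (fun p => T (Function.update y₀ i p)) (B i) :=
      hT.comp (contDiff_update _ y₀ i).contDiffOn fun p hp => hup _ hy₀ i p hp
    exact (PiLp.proj 2 W i : PiLp 2 W →L[ℝ] W i).contDiff.comp_contDiffOn h1
  · have := hcross i i (Function.update y₀ i p) (hup _ hy₀ i p hp) a b
    simpa using this
  · simp only [PiLp.inner_apply, h𝓓, sum_inner, inner_sum]
    rw [Finset.sum_comm, ← Finset.sum_neg_distrib]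
    refine Finset.sum_congr rfl fun i _ => ?_
    rw [← Finset.sum_neg_distrib]
    exact Finset.sum_congr rfl fun j _ => by linarith [hskew i j (y i) (z j)]
  · ext1 j
    have h1 := congrArg (fun w : PiLp 2 W => w j) (eq_sum_of_mixed hB hc hT2 hmix hy₀ hy)
    have h2 : ∀ i ≠ j, T (Function.update y₀ i (y i)) j - T y₀ j
        = D i j (F i (y i)) - D i j (F i (y₀ i)) := fun i hij => by
      rw [hD1 i j hij _ (hy i trivial), map_sub]
    have h3 : (∑ i, PiLp.single 2 i (T (Function.update y₀ i (y i)) i) : PiLp 2 W) j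
        = T (Function.update y₀ j (y j)) j := by
      simp [Finset.sum_apply, Finset.sum_pi_single]
    simp only [PiLp.sub_apply, h𝓓, h3, ← sub_eq_add_neg] at h1 ⊢
    rw [← Finset.sum_sub_distrib]
    simp only [WithLp.ofLp_sum, Finset.sum_apply, PiLp.sub_apply] at h1
    rw [← Finset.add_sum_erase _ _ (Finset.mem_univ j)] at h1 ⊢
    rw [hD0 j j rfl, Finset.sum_congr rfl fun i hi => (h2 i (Finset.ne_of_mem_erase hi)).symm]
    simp only [LinearMap.zero_apply, sub_self, zero_add]
    rw [sub_eq_iff_eq_add] at h1 ⊢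
    rw [h1]; abel

end Decomposition

/-! ### Finite products of manifolds. -/

section PiManifold

variable {ι : Type*} [Fintype ι] {E H : ι → Type*} [∀ i, NormedAddCommGroup (E i)]
  [∀ i, NormedSpace ℝ (E i)] [∀ i, TopologicalSpace (H i)]
  (I : ∀ i, ModelWithCorners ℝ (E i) (H i)) (k : ℕ∞ω) (M : ι → Type*)
  [∀ i, TopologicalSpace (M i)] [∀ i, ChartedSpace (H i) (M i)]

/-- Transition maps of the product atlas act factor by factor, so each component is a transition map
of one factor after a projection. -/
instance isManifold_pi [∀ i, IsManifold (I i) k (M i)] :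
    IsManifold (ModelWithCorners.pi I) k (∀ i, M i) := by
  refine isManifold_of_contDiffOn _ _ _ ?_
  rintro _ _ ⟨e, he, rfl⟩ ⟨e', he', rfl⟩
  refine contDiffOn_pi.2 fun i => ?_
  have h := (contDiffGroupoid k (I i)).compatible (he i trivial) (he' i trivial)
  refine ContDiffOn.comp (g := (I i) ∘ ((e i).symm ≫ₕ e' i) ∘ (I i).symm)
    (t := (I i).symm ⁻¹' ((e i).symm ≫ₕ e' i).source ∩ range (I i))
    h.1 (ContinuousLinearMap.proj (R := ℝ) (φ := E) i).contDiff.contDiffOn ?_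
  rintro y ⟨⟨hy1, hy2⟩, z, rfl⟩
  exact ⟨⟨hy1 i trivial, hy2 i trivial⟩, z i, rfl⟩

instance boundaryless_pi [∀ i, (I i).Boundaryless] : (ModelWithCorners.pi I).Boundaryless where
  range_eq_univ := by
    have : range (ModelWithCorners.pi I) = univ.pi fun i => range (I i) :=
      range_piMap fun i => I i
    rw [this]
    simp [ModelWithCorners.range_eq_univ]

end PiManifold

/-! ### Passing between the manifold and its charts. -/

section Chart

variable {E : Type*} [NormedAddCommGroup E] [NormedSpace ℝ E]
  {H : Type*} [TopologicalSpace H] {I : ModelWithCorners ℝ E H}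
  {M : Type*} [TopologicalSpace M] [ChartedSpace H M]
  {V : Type*} [NormedAddCommGroup V] [InnerProductSpace ℝ V]

/-- At the centre of the chart no differential of the chart intervenes, by the definition of
`mfderiv`; elsewhere `fderiv_comp_extChartAt_symm` is needed. -/
lemma diff_eq_fderiv [I.Boundaryless] {u : M → V} {x : M} (hu : MDifferentiableAt I 𝓘(ℝ, V) u x) :
    diff I u x = fderiv ℝ (u ∘ (extChartAt I x).symm) (extChartAt I x x) := by
  unfold diff
  rw [hu.mfderiv, I.range_eq_univ, fderivWithin_univ]
  rfl

variable [IsManifold I ∞ M]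

lemma contDiffOn_comp_extChartAt_symm {u : M → V} (hu : ContMDiff I 𝓘(ℝ, V) ∞ u) (x : M) :
    ContDiffOn ℝ ∞ (u ∘ (extChartAt I x).symm) (extChartAt I x).target :=
  (hu.comp_contMDiffOn (contMDiffOn_extChartAt_symm x)).contDiffOn

lemma diff_eq_fderiv_comp {u : M → V} {s : E → V} {x p : M} (hp : p ∈ (extChartAt I x).source)
    (hs : DifferentiableAt ℝ s (extChartAt I x p)) (h : u =ᶠ[nhds p] s ∘ extChartAt I x)
    (a : TangentSpace I p) :
    diff I u p a = fderiv ℝ s (extChartAt I x p) (mfderiv I 𝓘(ℝ, E) (extChartAt I x) p a) := by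
  have h1 : MDifferentiableAt I 𝓘(ℝ, E) (extChartAt I x) p :=
    ((contMDiffOn_extChartAt (I := I) (n := ∞) (x := x)).contMDiffAt
      ((chartAt H x).open_source.mem_nhds (by simpa using hp))).mdifferentiableAt (by simp)
  unfold diff
  rw [h.mfderiv_eq, mfderiv_comp p hs.mdifferentiableAt h1, mfderiv_eq_fderiv]
  rfl

variable [I.Boundaryless]

lemma contDiffAt_comp_extChartAt_symm {u : M → V} (hu : ContMDiff I 𝓘(ℝ, V) ∞ u) (x : M) {y : E}
    (hy : y ∈ (extChartAt I x).target) : ContDiffAt ℝ ∞ (u ∘ (extChartAt I x).symm) y :=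
  (contDiffOn_comp_extChartAt_symm hu x).contDiffAt ((isOpen_extChartAt_target x).mem_nhds hy)

lemma fderiv_comp_extChartAt_symm {u : M → V} (hu : ContMDiff I 𝓘(ℝ, V) ∞ u) (x : M) {y : E}
    (hy : y ∈ (extChartAt I x).target) (a : E) :
    fderiv ℝ (u ∘ (extChartAt I x).symm) y a
      = diff I u ((extChartAt I x).symm y) (mfderiv 𝓘(ℝ, E) I (extChartAt I x).symm y a) := by
  have h1 : MDifferentiableAt 𝓘(ℝ, E) I (extChartAt I x).symm y :=
    ((contMDiffOn_extChartAt_symm (I := I) (n := ∞) x).contMDiffAt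
      ((isOpen_extChartAt_target x).mem_nhds hy)).mdifferentiableAt (by simp)
  rw [← mfderiv_eq_fderiv, mfderiv_comp y (hu.mdifferentiableAt (by simp)) h1]
  rfl

lemma bending_in_chart {f T : M → V} (hf : ContMDiff I 𝓘(ℝ, V) ∞ f)
    (hT : IsInfinitesimalBendingOn I f T univ) (x : M) {y : E} (hy : y ∈ (extChartAt I x).target)
    (a b : E) :
    ⟪fderiv ℝ (T ∘ (extChartAt I x).symm) y a, fderiv ℝ (f ∘ (extChartAt I x).symm) y b⟫_ℝ
      + ⟪fderiv ℝ (f ∘ (extChartAt I x).symm) y a, fderiv ℝ (T ∘ (extChartAt I x).symm) y b⟫_ℝ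
        = 0 := by
  have hT' := contMDiffOn_univ.1 hT.smooth
  simp only [fderiv_comp_extChartAt_symm hf x hy, fderiv_comp_extChartAt_symm hT' x hy]
  exact hT.bending _ trivial _ _

/-- Isometry turns metric coefficients into products of coordinate derivatives of `f`, so the
Christoffel symbols can be studied through the immersion. -/
lemma chartMetric_eq_inner {g : ∀ x : M, TangentSpace I x → TangentSpace I x → ℝ} {f : M → V}
    (hf : IsIsometricImmersion I g f) (x : M) {y : E} (hy : y ∈ (extChartAt I x).target)
    (a b : E) :
    chartMetric I g x y a b = ⟪fderiv ℝ (f ∘ (extChartAt I x).symm) y a,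
      fderiv ℝ (f ∘ (extChartAt I x).symm) y b⟫_ℝ := by
  simp only [fderiv_comp_extChartAt_symm hf.smooth x hy]
  exact (hf.isometric _ _ _).symm

end Chart

/-! ### Mixed derivatives under product changes of coordinates. -/

section MixedDerivatives

variable {ι : Type*} [Fintype ι] [DecidableEq ι] {E : ι → Type*}
  [∀ i, NormedAddCommGroup (E i)] [∀ i, NormedSpace ℝ (E i)]
  {V : Type*} [NormedAddCommGroup V] [NormedSpace ℝ V]

lemma fderiv_comp_apply_single {y : ∀ i, E i} {i j : ι} (hij : i ≠ j) {h : E j → V}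
    (hh : DifferentiableAt ℝ h (y j)) (a : E i) :
    fderiv ℝ (fun z : ∀ i, E i => h (z j)) y (Pi.single i a) = 0 := by
  have := HasFDerivAt.comp (f := fun y : ∀ i, E i => y j) y hh.hasFDerivAt (hasFDerivAt_apply j y)
  have h2 : fderiv ℝ (fun z : ∀ i, E i => h (z j)) y = _ := this.fderiv
  rw [h2]
  simp [hij.symm]

/-- Vanishing of the mixed second derivatives is preserved by product coordinate changes. -/
lemma mixed_fderiv_comp_eq_zero {u : (∀ i, E i) → V} {φ : ∀ i, E i → E i} {y : ∀ i, E i}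
    (hφ : ∀ i, ContDiffAt ℝ 2 (φ i) (y i)) (hu : ContDiffAt ℝ 2 u fun i => φ i (y i))
    {i j : ι} (hij : i ≠ j)
    (h : ∀ (a : E i) (b : E j),
      fderiv ℝ (fderiv ℝ u) (fun i => φ i (y i)) (Pi.single i a) (Pi.single j b) = 0)
    (a : E i) (b : E j) :
    fderiv ℝ (fderiv ℝ fun z : ∀ i, E i => u fun i => φ i (z i)) y (Pi.single i a) (Pi.single j b)
      = 0 := by
  have hΦ : ∀ z : ∀ i, E i, (∀ i, DifferentiableAt ℝ (φ i) (z i)) →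
      HasFDerivAt (fun z i => φ i (z i)) (ContinuousLinearMap.pi fun i =>
        (fderiv ℝ (φ i) (z i)).comp (ContinuousLinearMap.proj i)) z := fun z hz =>
    hasFDerivAt_pi.2 fun i =>
      HasFDerivAt.comp (f := fun y : ∀ i, E i => y i) z (hz i).hasFDerivAt (hasFDerivAt_apply i z)
  have hΦs : ∀ z : ∀ i, E i, ∀ k (c : E k), (ContinuousLinearMap.pi fun i =>
      (fderiv ℝ (φ i) (z i)).comp (ContinuousLinearMap.proj (R := ℝ) i)) (Pi.single k c)
        = Pi.single k (fderiv ℝ (φ k) (z k) c) := by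
    intro z k c
    ext l
    by_cases hl : l = k
    · subst hl; simp
    · simp [hl]
  have hφy : ∀ i, DifferentiableAt ℝ (φ i) (y i) := fun i => (hφ i).differentiableAt (by simp)
  have hev : ∀ᶠ z in nhds y, ∀ i, DifferentiableAt ℝ (φ i) (z i) := by
    refine Filter.eventually_all.2 fun i => ?_
    filter_upwards [(continuousAt_apply i y).eventually ((hφ i).eventually (by simp))] with z hz
      using hz.differentiableAt (by simp)
  have hevu : ∀ᶠ z in nhds y, DifferentiableAt ℝ u fun i => φ i (z i) := by
    filter_upwards [(hΦ y hφy).continuousAt.eventually (hu.eventually (by simp))] with z hz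
      using hz.differentiableAt (by simp)
  have hcomp : ContDiffAt ℝ 2 (fun z : ∀ i, E i => u fun i => φ i (z i)) y :=
    hu.comp y (contDiffAt_pi.2 fun i => (hφ i).comp y
      (ContinuousLinearMap.proj (R := ℝ) (φ := E) i).contDiff.contDiffAt)
  have hdd : ∀ (v : (∀ i, E i) → V) (y b : ∀ i, E i), ContDiffAt ℝ 2 v y → ∀ a,
      fderiv ℝ (fun z => fderiv ℝ v z b) y a = fderiv ℝ (fderiv ℝ v) y a b := by
    intro v y b hv a
    rw [fderiv_clm_apply ((hv.fderiv_right (m := 1) (by norm_num)).differentiableAt (by simp))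
      (differentiableAt_const b)]
    simp
  rw [← hdd _ _ _ hcomp]
  -- The vector fed to `fderiv ℝ u` depends on `z j` only, so the derivative in direction `i` falls
  -- on `fderiv ℝ u` alone and is again a mixed one.
  have heq : (fun z => fderiv ℝ (fun z : ∀ i, E i => u fun i => φ i (z i)) z (Pi.single j b))
      =ᶠ[nhds y] fun z => fderiv ℝ u (fun i => φ i (z i))
        (ContinuousLinearMap.single ℝ E j (fderiv ℝ (φ j) (z j) b)) := by
    filter_upwards [hev, hevu] with z hz hzu
    have h1 : fderiv ℝ (fun z : ∀ i, E i => u fun i => φ i (z i)) z = _ :=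
      (hzu.hasFDerivAt.comp z (hΦ z hz)).fderiv
    rw [h1, ContinuousLinearMap.comp_apply, hΦs]
    rfl
  rw [heq.fderiv_eq]
  have hDu : DifferentiableAt ℝ (fderiv ℝ u) fun i => φ i (y i) :=
    (hu.fderiv_right (m := 1) (by norm_num)).differentiableAt (by simp)
  have hs : DifferentiableAt ℝ (fun p => ContinuousLinearMap.single ℝ E j (fderiv ℝ (φ j) p b))
      (y j) :=
    (ContinuousLinearMap.single ℝ E j).differentiableAt.comp (y j)
      ((((hφ j).fderiv_right (m := 1) (by norm_num)).differentiableAt (by simp)).clm_apply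
        (differentiableAt_const b))
  have hA := hDu.hasFDerivAt.comp y (hΦ y hφy)
  have hB : DifferentiableAt ℝ
      (fun z : ∀ i, E i => ContinuousLinearMap.single ℝ E j (fderiv ℝ (φ j) (z j) b)) y :=
    DifferentiableAt.comp (f := fun z : ∀ i, E i => z j)
      (g := fun p => ContinuousLinearMap.single ℝ E j (fderiv ℝ (φ j) p b)) y hs
      (differentiableAt_apply j y)
  have hP := (hA.clm_apply hB.hasFDerivAt).fderiv
  have hP' := congrArg (fun L : (∀ i, E i) →L[ℝ] V => L (Pi.single i a)) hP
  refine Eq.trans hP' ?_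
  simp only [add_apply, ContinuousLinearMap.comp_apply, ContinuousLinearMap.flip_apply, hΦs,
    fderiv_comp_apply_single hij hs, map_zero, zero_add]
  exact h _ _

end MixedDerivatives

/-! ### Extrinsic products and adapted bendings in product charts. -/

section Product

variable {r : ℕ} {n m : Fin r → ℕ}
  {M : Fin r → Type*} [∀ i, TopologicalSpace (M i)]
  [∀ i, ChartedSpace (EuclideanSpace ℝ (Fin (n i))) (M i)]

lemma extChartAt_prodModel_target (x : ∀ i, M i) : (extChartAt (prodModel n) x).target
    = univ.pi fun i => (extChartAt (𝓡 (n i)) (x i)).target := by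
  ext y
  rw [extChartAt_target, ModelWithCorners.range_eq_univ, inter_univ]
  simp only [extChartAt_target, ModelWithCorners.range_eq_univ, inter_univ]
  rfl

lemma extChartAt_prodModel_source (x : ∀ i, M i) : (extChartAt (prodModel n) x).source
    = univ.pi fun i => (extChartAt (𝓡 (n i)) (x i)).source := by
  simp only [extChartAt_source]
  rfl

lemma extrinsicProduct_comp_extChartAt_symm (f : ∀ i, M i → EuclideanSpace ℝ (Fin (m i)))
    (x : ∀ i, M i) : extrinsicProduct f ∘ (extChartAt (prodModel n) x).symm
      = fun y : ∀ i, EuclideanSpace ℝ (Fin (n i)) =>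
        (WithLp.toLp 2 fun i => (f i ∘ (extChartAt (𝓡 (n i)) (x i)).symm) (y i) : Ambient m) :=
  rfl

variable [∀ i, IsManifold (𝓡 (n i)) ∞ (M i)]

lemma contMDiff_extrinsicProduct {f : ∀ i, M i → EuclideanSpace ℝ (Fin (m i))}
    (hf : ∀ i, ContMDiff (𝓡 (n i)) 𝓘(ℝ, EuclideanSpace ℝ (Fin (m i))) ∞ (f i)) :
    ContMDiff (prodModel n) 𝓘(ℝ, Ambient m) ∞ (extrinsicProduct f) := by
  intro x
  refine contMDiffAt_iff.2 ⟨?_, ?_⟩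
  · refine (PiLp.continuous_toLp 2 _).continuousAt.comp (continuousAt_pi.2 fun i => ?_)
    exact (hf i).continuous.continuousAt.comp (continuousAt_apply i x)
  · rw [ModelWithCorners.range_eq_univ, contDiffWithinAt_univ]
    refine (PiLp.continuousLinearEquiv 2 ℝ fun i => EuclideanSpace ℝ
      (Fin (m i))).symm.contDiff.contDiffAt.comp (extChartAt (prodModel n) x x)
      (contDiffAt_pi.2 fun i => ?_)
    exact ContDiffAt.comp (g := f i ∘ (extChartAt (𝓡 (n i)) (x i)).symm)
      (f := fun y : ∀ i, EuclideanSpace ℝ (Fin (n i)) => y i) (extChartAt (prodModel n) x x)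
      (contDiffAt_comp_extChartAt_symm (hf i) (x i) (mem_extChartAt_target (x i)))
      (ContinuousLinearMap.proj (R := ℝ) (φ := fun i => EuclideanSpace ℝ (Fin (n i)))
        i).contDiff.contDiffAt

lemma fderiv_extrinsicProduct_single {f : ∀ i, M i → EuclideanSpace ℝ (Fin (m i))}
    (hf : ∀ i, ContMDiff (𝓡 (n i)) 𝓘(ℝ, EuclideanSpace ℝ (Fin (m i))) ∞ (f i))
    (x : ∀ i, M i) {y : ∀ i, EuclideanSpace ℝ (Fin (n i))}
    (hy : y ∈ (extChartAt (prodModel n) x).target) (j : Fin r)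
    (b : EuclideanSpace ℝ (Fin (n j))) :
    fderiv ℝ (extrinsicProduct f ∘ (extChartAt (prodModel n) x).symm) y (Pi.single j b)
      = PiLp.single 2 j (fderiv ℝ (f j ∘ (extChartAt (𝓡 (n j)) (x j)).symm) (y j) b) := by
  rw [extChartAt_prodModel_target] at hy
  rw [extrinsicProduct_comp_extChartAt_symm, fderiv_toLp_pi_single]
  exact fun i => (contDiffAt_comp_extChartAt_symm (hf i) (x i) (hy i trivial)).differentiableAt
    (by simp)

lemma isIsometricImmersion_extrinsicProduct
    {g : ∀ i, ContMDiffRiemannianMetric (𝓡 (n i)) ∞ (EuclideanSpace ℝ (Fin (n i)))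
      (fun x : M i => TangentSpace (𝓡 (n i)) x)}
    {f : ∀ i, M i → EuclideanSpace ℝ (Fin (m i))}
    (hf : ∀ i, IsIsometricImmersion (𝓡 (n i)) (fun x X Y => (g i).inner x X Y) (f i)) :
    IsIsometricImmersion (prodModel n) (prodMetric g) (extrinsicProduct f) := by
  have hs := contMDiff_extrinsicProduct fun i => (hf i).smooth
  refine ⟨hs, fun x X Y => ?_⟩
  have hd : ∀ Z : ∀ i, EuclideanSpace ℝ (Fin (n i)), ∀ i,
      diff (prodModel n) (extrinsicProduct f) x Z i = diff (𝓡 (n i)) (f i) (x i) (Z i) := by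
    intro Z i
    rw [diff_eq_fderiv (hs.mdifferentiableAt (by simp)),
      diff_eq_fderiv ((hf i).smooth.mdifferentiableAt (by simp)),
      extrinsicProduct_comp_extChartAt_symm,
      (hasFDerivAt_toLp_pi (y := extChartAt (prodModel n) x x) fun i => (contDiffAt_comp_extChartAt_symm (hf i).smooth (x i)
          (mem_extChartAt_target (x i))).differentiableAt (by simp)).fderiv]
    rfl
  rw [PiLp.inner_apply]
  refine Finset.sum_congr rfl fun i _ => ?_
  exact (congrArg₂ (fun u v => ⟪u, v⟫_ℝ) (hd X i) (hd Y i)).trans ((hf i).isometric _ _ _)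

variable {g : ∀ i, ContMDiffRiemannianMetric (𝓡 (n i)) ∞ (EuclideanSpace ℝ (Fin (n i)))
      (fun x : M i => TangentSpace (𝓡 (n i)) x)}
    {f : ∀ i, M i → EuclideanSpace ℝ (Fin (m i))}

lemma eq_zero_of_prodMetric_self_eq_zero {x : ∀ i, M i} {X : ∀ i, EuclideanSpace ℝ (Fin (n i))}
    (h : prodMetric g x X X = 0) : X = 0 := by
  have hpos : ∀ i, X i ≠ 0 → 0 < (g i).inner (x i) (X i) (X i) := fun i hi => (g i).pos _ _ hi
  have hnn : ∀ i ∈ Finset.univ, 0 ≤ (g i).inner (x i) (X i) (X i) := by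
    intro i _
    by_cases hi : X i = 0
    · rw [hi]
      exact (map_zero ((g i).inner (x i) 0)).ge
    · exact (hpos i hi).le
  ext1 i
  by_contra hi
  exact (hpos i hi).ne' ((Finset.sum_eq_zero_iff_of_nonneg hnn).1 h i (Finset.mem_univ i))

/-- The derivative of the product in a direction of factor `j` is a function of the `j`-th
coordinate only. -/
lemma fderiv_fderiv_extrinsicProduct_mixed
    (hf : ∀ i, ContMDiff (𝓡 (n i)) 𝓘(ℝ, EuclideanSpace ℝ (Fin (m i))) ∞ (f i)) (x : ∀ i, M i)
    {i j : Fin r} (hij : i ≠ j) (a : EuclideanSpace ℝ (Fin (n i)))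
    (b : EuclideanSpace ℝ (Fin (n j))) :
    fderiv ℝ (fderiv ℝ (extrinsicProduct f ∘ (extChartAt (prodModel n) x).symm))
      (extChartAt (prodModel n) x x) (Pi.single i a) (Pi.single j b) = 0 := by
  have hF := contDiffAt_comp_extChartAt_symm (contMDiff_extrinsicProduct hf) x
    (mem_extChartAt_target x)
  have hj := contDiffAt_comp_extChartAt_symm (hf j) (x j) (mem_extChartAt_target (x j))
  rw [← fderiv_fderiv_apply (hF.of_le (by norm_cast))]
  have heq : (fun z => fderiv ℝ (extrinsicProduct f ∘ (extChartAt (prodModel n) x).symm) z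
      (Pi.single j b)) =ᶠ[nhds (extChartAt (prodModel n) x x)]
      fun z => (PiLp.single 2 j (fderiv ℝ (f j ∘ (extChartAt (𝓡 (n j)) (x j)).symm) (z j) b) :
        Ambient m) := by
    filter_upwards [(isOpen_extChartAt_target x).mem_nhds (mem_extChartAt_target x)] with z hz
      using fderiv_extrinsicProduct_single hf x hz j b
  rw [heq.fderiv_eq]
  refine fderiv_comp_apply_single (E := fun i => EuclideanSpace ℝ (Fin (n i))) hij (h := fun p => (PiLp.single 2 j
    (fderiv ℝ (f j ∘ (extChartAt (𝓡 (n j)) (x j)).symm) p b) : Ambient m)) ?_ a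
  have hd : DifferentiableAt ℝ (fun p => fderiv ℝ (f j ∘ (extChartAt (𝓡 (n j)) (x j)).symm) p b)
      (extChartAt (𝓡 (n j)) (x j) (x j)) :=
    (differentiableAt_fderiv_apply (hj.of_le (by norm_cast))).clm_apply (differentiableAt_const b)
  exact ((((PiLp.continuousLinearEquiv 2 ℝ fun i => EuclideanSpace ℝ (Fin (m i))).symm :
    (∀ i, EuclideanSpace ℝ (Fin (m i))) →L[ℝ] Ambient m).comp
    (ContinuousLinearMap.single ℝ _ j)).differentiableAt).comp _ hd

/-- The metric is block diagonal in a product chart, and the `j`-th block depends on `y j` only.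
Both vanishing results for its derivatives follow from this. -/
lemma chartMetric_single
    (hf : ∀ i, IsIsometricImmersion (𝓡 (n i)) (fun x X Y => (g i).inner x X Y) (f i))
    (x : ∀ i, M i) {y : ∀ i, EuclideanSpace ℝ (Fin (n i))}
    (hy : y ∈ (extChartAt (prodModel n) x).target) (j : Fin r)
    (b : EuclideanSpace ℝ (Fin (n j))) (c : ∀ i, EuclideanSpace ℝ (Fin (n i))) :
    chartMetric (prodModel n) (prodMetric g) x y (Pi.single j b) c
      = ⟪fderiv ℝ (f j ∘ (extChartAt (𝓡 (n j)) (x j)).symm) (y j) b,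
        fderiv ℝ (f j ∘ (extChartAt (𝓡 (n j)) (x j)).symm) (y j) (c j)⟫_ℝ := by
  rw [chartMetric_eq_inner (isIsometricImmersion_extrinsicProduct hf) x hy,
    fderiv_extrinsicProduct_single (fun i => (hf i).smooth) x hy, inner_piLp_single_left]
  congr 1
  rw [extChartAt_prodModel_target] at hy
  rw [extrinsicProduct_comp_extChartAt_symm, (hasFDerivAt_toLp_pi fun i =>
    (contDiffAt_comp_extChartAt_symm (hf i).smooth (x i) (hy i trivial)).differentiableAt
      (by simp)).fderiv]
  rfl

lemma chartMetricDeriv_single_single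
    (hf : ∀ i, IsIsometricImmersion (𝓡 (n i)) (fun x X Y => (g i).inner x X Y) (f i))
    (x : ∀ i, M i) {i j : Fin r} (hij : i ≠ j) (a : EuclideanSpace ℝ (Fin (n i)))
    (b : EuclideanSpace ℝ (Fin (n j))) (c : ∀ i, EuclideanSpace ℝ (Fin (n i))) :
    chartMetricDeriv (prodModel n) (prodMetric g) x (Pi.single i a) (Pi.single j b) c = 0 := by
  have hd := differentiableAt_fderiv_apply ((contDiffAt_comp_extChartAt_symm (hf j).smooth (x j)
    (mem_extChartAt_target (x j))).of_le (m := 2) (by norm_cast))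
  unfold chartMetricDeriv
  have heq : (fun y => chartMetric (prodModel n) (prodMetric g) x y (Pi.single j b) c)
      =ᶠ[nhds (extChartAt (prodModel n) x x)] fun y =>
      ⟪fderiv ℝ (f j ∘ (extChartAt (𝓡 (n j)) (x j)).symm) (y j) b,
        fderiv ℝ (f j ∘ (extChartAt (𝓡 (n j)) (x j)).symm) (y j) (c j)⟫_ℝ := by
    filter_upwards [(isOpen_extChartAt_target x).mem_nhds (mem_extChartAt_target x)] with z hz
      using chartMetric_single hf x hz j b c
  rw [heq.fderiv_eq]
  exact fderiv_comp_apply_single (E := fun i => EuclideanSpace ℝ (Fin (n i))) hij (h := fun p =>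
    ⟪fderiv ℝ (f j ∘ (extChartAt (𝓡 (n j)) (x j)).symm) p b,
        fderiv ℝ (f j ∘ (extChartAt (𝓡 (n j)) (x j)).symm) p (c j)⟫_ℝ)
    ((hd.clm_apply (differentiableAt_const b)).inner ℝ
      (hd.clm_apply (differentiableAt_const (c j)))) a

lemma chartMetricDeriv_mixed
    (hf : ∀ i, IsIsometricImmersion (𝓡 (n i)) (fun x X Y => (g i).inner x X Y) (f i))
    (x : ∀ i, M i) {i j : Fin r} (hij : i ≠ j) (a : EuclideanSpace ℝ (Fin (n i)))
    (b : EuclideanSpace ℝ (Fin (n j))) (c : ∀ i, EuclideanSpace ℝ (Fin (n i))) :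
    chartMetricDeriv (prodModel n) (prodMetric g) x c (Pi.single i a) (Pi.single j b) = 0 := by
  unfold chartMetricDeriv
  have heq : (fun y => chartMetric (prodModel n) (prodMetric g) x y (Pi.single i a)
      (Pi.single j b)) =ᶠ[nhds (extChartAt (prodModel n) x x)] fun _ => (0 : ℝ) := by
    filter_upwards [(isOpen_extChartAt_target x).mem_nhds (mem_extChartAt_target x)] with z hz
    rw [chartMetric_single hf x hz, Pi.single_eq_of_ne hij, map_zero, inner_zero_right]
  rw [heq.fderiv_eq]
  simp

/-- Mixed Christoffel symbols of a product metric vanish in a product chart. -/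
lemma christoffel_mixed
    (hf : ∀ i, IsIsometricImmersion (𝓡 (n i)) (fun x X Y => (g i).inner x X Y) (f i))
    (x : ∀ i, M i) {i j : Fin r} (hij : i ≠ j) (a : EuclideanSpace ℝ (Fin (n i)))
    (b : EuclideanSpace ℝ (Fin (n j))) :
    christoffel (prodModel n) (prodMetric g) x (Pi.single i a) (Pi.single j b) = 0 := by
  have hiso := isIsometricImmersion_extrinsicProduct hf
  have hrhs : ∀ c, (chartMetricDeriv (prodModel n) (prodMetric g) x (Pi.single i a)
      (Pi.single j b) c + chartMetricDeriv (prodModel n) (prodMetric g) x (Pi.single j b)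
      (Pi.single i a) c - chartMetricDeriv (prodModel n) (prodMetric g) x c (Pi.single i a)
      (Pi.single j b)) / 2 = 0 := fun c => by
    rw [chartMetricDeriv_single_single hf x hij, chartMetricDeriv_single_single hf x hij.symm,
      chartMetricDeriv_mixed hf x hij]
    simp
  have hex : ∃ w : ∀ i, EuclideanSpace ℝ (Fin (n i)), ∀ c,
      chartMetric (prodModel n) (prodMetric g) x (extChartAt (prodModel n) x x) w c
        = (chartMetricDeriv (prodModel n) (prodMetric g) x (Pi.single i a)
      (Pi.single j b) c + chartMetricDeriv (prodModel n) (prodMetric g) x (Pi.single j b)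
      (Pi.single i a) c - chartMetricDeriv (prodModel n) (prodMetric g) x c (Pi.single i a)
      (Pi.single j b)) / 2 := by
    refine ⟨0, fun c => ?_⟩
    rw [hrhs, chartMetric_eq_inner hiso x (mem_extChartAt_target x), map_zero, inner_zero_left]
  -- `christoffel` is a chosen solution, so solvability (by `0`) must come first; testing the chosen
  -- vector against itself and positive definiteness then show that it is zero.
  have hw := Classical.epsilon_spec hex
    (christoffel (prodModel n) (prodMetric g) x (Pi.single i a) (Pi.single j b))
  rw [hrhs, chartMetric_eq_inner hiso x (mem_extChartAt_target x),
    ← diff_eq_fderiv (hiso.smooth.mdifferentiableAt (by simp))] at hw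
  exact eq_zero_of_prodMetric_self_eq_zero ((hiso.isometric x _ _).symm.trans hw)

/-- An adapted bending has vanishing mixed second derivatives at `x` in the chart at `x`. -/
lemma fderiv_fderiv_bending_mixed_self
    (hf : ∀ i, IsIsometricImmersion (𝓡 (n i)) (fun x X Y => (g i).inner x X Y) (f i))
    {T : (∀ i, M i) → Ambient m}
    (hT : IsInfinitesimalBendingOn (prodModel n) (extrinsicProduct f) T univ)
    (hβ : IsAdapted (prodMetric g) (extrinsicProduct f) T)
    (x : ∀ i, M i) {i j : Fin r} (hij : i ≠ j) (a : EuclideanSpace ℝ (Fin (n i)))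
    (b : EuclideanSpace ℝ (Fin (n j))) :
    fderiv ℝ (fderiv ℝ (T ∘ (extChartAt (prodModel n) x).symm))
      (extChartAt (prodModel n) x x) (Pi.single i a) (Pi.single j b) = 0 := by
  have hiso := isIsometricImmersion_extrinsicProduct hf
  have hT' := contMDiffOn_univ.1 hT.smooth
  set w := fderiv ℝ (fderiv ℝ (T ∘ (extChartAt (prodModel n) x).symm))
      (extChartAt (prodModel n) x x) (Pi.single i a) (Pi.single j b) with hw
  have hhess : hessian (prodModel n) (prodMetric g) T x (inclTangent x i a) (inclTangent x j b)
      = w := by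
    have h0 : christoffel (prodModel n) (prodMetric g) x (inclTangent x i a) (inclTangent x j b)
        = 0 := christoffel_mixed hf x hij a b
    unfold hessian
    rw [h0, map_zero, sub_zero]
    rfl
  have h1 := hβ x i j hij a b
  unfold bendingTensor at h1
  rw [hhess, Submodule.starProjection_apply_eq_zero_iff, normalSpace,
    Submodule.orthogonal_orthogonal] at h1
  -- The normal part of `w` vanishes, so `w` is the image of some `c`; the differentiated bending
  -- equation tested on this `c` gives `⟪w, w⟫ = 0`.
  obtain ⟨c, hc⟩ := h1
  have h2 := inner_fderiv_fderiv_add_eq_zero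
    ((contDiffAt_comp_extChartAt_symm hT' x (mem_extChartAt_target x)).of_le (by norm_cast))
    ((contDiffAt_comp_extChartAt_symm hiso.smooth x (mem_extChartAt_target x)).of_le
      (by norm_cast))
    (by
      filter_upwards [(isOpen_extChartAt_target x).mem_nhds (mem_extChartAt_target x)] with z hz
        using bending_in_chart hiso.smooth hT x hz)
    (Pi.single i a) (Pi.single j b) c
  rw [fderiv_fderiv_extrinsicProduct_mixed (fun i => (hf i).smooth) x hij, inner_zero_right,
    add_zero, ← hw, ← diff_eq_fderiv (hiso.smooth.mdifferentiableAt (by simp))] at h2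
  have hc' : diff (prodModel n) (extrinsicProduct f) x c = w := hc
  rwa [hc', inner_self_eq_zero] at h2

/-- An adapted bending has vanishing mixed second derivatives in every product chart. -/
lemma fderiv_fderiv_bending_mixed
    (hf : ∀ i, IsIsometricImmersion (𝓡 (n i)) (fun x X Y => (g i).inner x X Y) (f i))
    {T : (∀ i, M i) → Ambient m}
    (hT : IsInfinitesimalBendingOn (prodModel n) (extrinsicProduct f) T univ)
    (hβ : IsAdapted (prodMetric g) (extrinsicProduct f) T)
    (x₀ : ∀ i, M i) {y : ∀ i, EuclideanSpace ℝ (Fin (n i))}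
    (hy : y ∈ (extChartAt (prodModel n) x₀).target) {i j : Fin r} (hij : i ≠ j)
    (a : EuclideanSpace ℝ (Fin (n i))) (b : EuclideanSpace ℝ (Fin (n j))) :
    fderiv ℝ (fderiv ℝ (T ∘ (extChartAt (prodModel n) x₀).symm)) y (Pi.single i a) (Pi.single j b)
      = 0 := by
  have hT' := contMDiffOn_univ.1 hT.smooth
  set x := (extChartAt (prodModel n) x₀).symm y with hx
  have hyi : ∀ i, y i ∈ (extChartAt (𝓡 (n i)) (x₀ i)).target := fun i => by
    rw [extChartAt_prodModel_target] at hy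
    exact hy i trivial
  -- `hessian` at `x` is computed in the chart centred at `x`, whereas separation needs one fixed
  -- chart at `x₀` for all points; the transition between the two is a product map.
  let φ : ∀ i, EuclideanSpace ℝ (Fin (n i)) → EuclideanSpace ℝ (Fin (n i)) := fun i =>
    extChartAt (𝓡 (n i)) (x i) ∘ (extChartAt (𝓡 (n i)) (x₀ i)).symm
  have hφ : ∀ i, ContDiffAt ℝ 2 (φ i) (y i) := by
    intro i
    have h1 : ContMDiffAt (𝓡 (n i)) (𝓡 (n i)) ∞ (extChartAt (𝓡 (n i)) (x i))
        ((extChartAt (𝓡 (n i)) (x₀ i)).symm (y i)) :=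
      contMDiffAt_extChartAt
    have h2 : ContMDiffAt (𝓡 (n i)) (𝓡 (n i)) ∞ (extChartAt (𝓡 (n i)) (x₀ i)).symm (y i) :=
      (contMDiffOn_extChartAt_symm (x₀ i)).contMDiffAt
        ((isOpen_extChartAt_target (x₀ i)).mem_nhds (hyi i))
    exact ((h1.comp (y i) h2).contDiffAt).of_le (by norm_cast)
  have heq : T ∘ (extChartAt (prodModel n) x₀).symm =ᶠ[nhds y] fun z : ∀ i, _ =>
      (T ∘ (extChartAt (prodModel n) x).symm) fun i => φ i (z i) := by
    have hcont := continuousAt_extChartAt_symm'' (I := prodModel n) hy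
    filter_upwards [hcont.eventually (extChartAt_source_mem_nhds (I := prodModel n) x)] with z hz
    exact congrArg T ((extChartAt (prodModel n) x).left_inv hz).symm
  rw [heq.fderiv.fderiv_eq]
  exact mixed_fderiv_comp_eq_zero hφ
    ((contDiffAt_comp_extChartAt_symm hT' x (mem_extChartAt_target x)).of_le (by norm_cast)) hij
    (fun a b => fderiv_fderiv_bending_mixed_self hf hT hβ x hij a b) a b

/-- If `f` has full first normal spaces, then no factor is locally contained in a hyperplane. -/
lemma eq_zero_of_forall_inner_sub_eq_zero
    (hf : ∀ i, ContMDiff (𝓡 (n i)) 𝓘(ℝ, EuclideanSpace ℝ (Fin (m i))) ∞ (f i)) {x : ∀ i, M i}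
    (hfull : HasFullFirstNormalSpace (prodModel n) (prodMetric g) (extrinsicProduct f) x)
    {i : Fin r} {B : Set (EuclideanSpace ℝ (Fin (n i)))}
    (hB : B ∈ nhds (extChartAt (𝓡 (n i)) (x i) (x i))) {w : EuclideanSpace ℝ (Fin (m i))}
    (h : ∀ p ∈ B, ⟪w, (f i ∘ (extChartAt (𝓡 (n i)) (x i)).symm) p
      - (f i ∘ (extChartAt (𝓡 (n i)) (x i)).symm) (extChartAt (𝓡 (n i)) (x i) (x i))⟫_ℝ = 0) :
    w = 0 := by
  have hs := contMDiff_extrinsicProduct hf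
  have hF := contDiffAt_comp_extChartAt_symm hs x (mem_extChartAt_target x)
  obtain ⟨h1, h2⟩ := inner_derivs_eq_zero (hF.of_le (by norm_cast))
    (w := (PiLp.single 2 i w : Ambient m))
    (c := ⟪w, (f i ∘ (extChartAt (𝓡 (n i)) (x i)).symm) (extChartAt (𝓡 (n i)) (x i) (x i))⟫_ℝ) (by
      filter_upwards [(continuousAt_apply i (extChartAt (prodModel n) x x)).eventually hB] with z hz
      rw [inner_piLp_single_left]
      have := h _ hz
      rw [inner_sub_right, sub_eq_zero] at this
      exact this)
  rw [← diff_eq_fderiv (hs.mdifferentiableAt (by simp))] at h1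
  have hN : (PiLp.single 2 i w : Ambient m) ∈ normalSpace (prodModel n) (extrinsicProduct f) x := by
    refine (Submodule.mem_orthogonal' _ _).2 ?_
    rintro _ ⟨c, rfl⟩
    exact h1 c
  -- The embedded `w` is normal and orthogonal to all second derivatives of `f`, hence to every
  -- `α(X, Y)`. These span the normal space, so the vector is orthogonal to itself.
  have hself : ∀ v ∈ normalSpace (prodModel n) (extrinsicProduct f) x,
      ⟪(PiLp.single 2 i w : Ambient m), v⟫_ℝ = 0 := by
    rw [← hfull]
    intro v hv
    induction hv using Submodule.span_induction with
    | mem v hv =>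
      obtain ⟨X, Y, rfl⟩ := hv
      unfold secondFundamentalForm
      rw [← Submodule.inner_starProjection_left_eq_right,
        Submodule.starProjection_eq_self_iff.2 hN]
      unfold hessian
      rw [inner_sub_right, h1, sub_zero]
      exact h2 X Y
    | zero => simp
    | add u v _ _ hu hv => rw [inner_add_right, hu, hv, add_zero]
    | smul c v _ hv => rw [inner_smul_right, hv, mul_zero]
  have := hself _ hN
  rwa [inner_piLp_single_left, PiLp.single_eq_same, inner_self_eq_zero] at this

end Product

end InfBending

end

/-! ### The local decomposition on the manifold. -/

theorem mainTheorem5 {r : ℕ} {n m : Fin r → ℕ} (hn : ∀ i, 2 ≤ n i)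
    {M : Fin r → Type*} [∀ i, TopologicalSpace (M i)]
    [∀ i, ChartedSpace (EuclideanSpace ℝ (Fin (n i))) (M i)]
    [∀ i, IsManifold (𝓡 (n i)) ∞ (M i)]
    (g : ∀ i, ContMDiffRiemannianMetric (𝓡 (n i)) ∞ (EuclideanSpace ℝ (Fin (n i)))
      (fun x : M i => TangentSpace (𝓡 (n i)) x))
    (f : ∀ i, M i → EuclideanSpace ℝ (Fin (m i)))
    (hf : ∀ i, InfBending.IsIsometricImmersion (𝓡 (n i)) (fun x X Y => (g i).inner x X Y) (f i))
    (hfull : ∀ x : ∀ i, M i, InfBending.HasFullFirstNormalSpace (InfBending.prodModel n)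
      (InfBending.prodMetric g) (InfBending.extrinsicProduct f) x)
    (T : (∀ i, M i) → InfBending.Ambient m)
    (hT : InfBending.IsInfinitesimalBendingOn (InfBending.prodModel n)
      (InfBending.extrinsicProduct f) T Set.univ)
    (hβ : InfBending.IsAdapted (InfBending.prodMetric g) (InfBending.extrinsicProduct f) T) :
    ∀ x₀ : ∀ i, M i, ∃ (U : ∀ i, Set (M i)) (T' : ∀ i, M i → EuclideanSpace ℝ (Fin (m i))),
      (∀ i, x₀ i ∈ U i) ∧
      (∀ i, InfBending.IsInfinitesimalBendingOn (𝓡 (n i)) (f i) (T' i) (U i)) ∧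
      InfBending.IsTrivialBendingOn (InfBending.extrinsicProduct f)
        (fun x => T x - ∑ i, PiLp.single 2 i (T' i (x i))) (Set.univ.pi U) := by
  intro x₀
  have hiso := InfBending.isIsometricImmersion_extrinsicProduct hf
  have hT' := contMDiffOn_univ.1 hT.smooth
  have hball : ∀ i, ∃ ε > 0, Metric.ball (extChartAt (𝓡 (n i)) (x₀ i) (x₀ i)) ε
      ⊆ (extChartAt (𝓡 (n i)) (x₀ i)).target := fun i =>
    Metric.isOpen_iff.1 (isOpen_extChartAt_target (x₀ i)) _ (mem_extChartAt_target (x₀ i))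
  choose ε hε hεt using hball
  -- Balls make the coordinate box open and convex inside the target of the product chart.
  let B : ∀ i, Set (EuclideanSpace ℝ (Fin (n i))) := fun i =>
    Metric.ball (extChartAt (𝓡 (n i)) (x₀ i) (x₀ i)) (ε i)
  have hBt : univ.pi B ⊆ (extChartAt (InfBending.prodModel n) x₀).target := by
    rw [InfBending.extChartAt_prodModel_target]
    exact pi_mono fun i _ => hεt i
  obtain ⟨S, hS, hSb, D, v, hD, hTD⟩ := InfBending.exists_bending_decomposition (B := B)
    (F := fun i => f i ∘ (extChartAt (𝓡 (n i)) (x₀ i)).symm)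
    (T := T ∘ (extChartAt (InfBending.prodModel n) x₀).symm)
    (y₀ := extChartAt (InfBending.prodModel n) x₀ x₀)
    (fun i => Metric.isOpen_ball) (fun i => convex_ball _ _)
    (fun i => (InfBending.contDiffOn_comp_extChartAt_symm (hf i).smooth (x₀ i)).mono (hεt i))
    ((InfBending.contDiffOn_comp_extChartAt_symm hT' x₀).mono hBt)
    (fun y hy a b => InfBending.bending_in_chart hiso.smooth hT x₀ (hBt hy) a b)
    (fun y hy i j hij a b =>
      InfBending.fderiv_fderiv_bending_mixed hf hT hβ x₀ (hBt hy) hij a b)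
    (fun i _ => Metric.mem_ball_self (hε i))
    (fun i w hw => InfBending.eq_zero_of_forall_inner_sub_eq_zero (fun i => (hf i).smooth)
      (hfull x₀) (Metric.ball_mem_nhds _ (hε i)) hw)
  let U : ∀ i, Set (M i) := fun i =>
    (extChartAt (𝓡 (n i)) (x₀ i)).source ∩ extChartAt (𝓡 (n i)) (x₀ i) ⁻¹' B i
  have hUo : ∀ i, IsOpen (U i) := fun i => isOpen_extChartAt_preimage' (x₀ i) Metric.isOpen_ball
  refine ⟨U, fun i => S i ∘ extChartAt (𝓡 (n i)) (x₀ i),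
    fun i => ⟨mem_extChartAt_source (x₀ i), Metric.mem_ball_self (hε i)⟩,
    fun i => ⟨hUo i, ?_, fun p hp X Y => ?_⟩, D, v, hD, fun x hx => ?_⟩
  · refine (hS i).contMDiffOn.comp (contMDiffOn_extChartAt.mono ?_) inter_subset_right
    rw [← extChartAt_source (𝓡 (n i))]
    exact inter_subset_left
  · have hSd : DifferentiableAt ℝ (S i) (extChartAt (𝓡 (n i)) (x₀ i) p) :=
      ((hS i).contDiffAt (Metric.isOpen_ball.mem_nhds hp.2)).differentiableAt (by simp)
    have hFd : DifferentiableAt ℝ (f i ∘ (extChartAt (𝓡 (n i)) (x₀ i)).symm)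
        (extChartAt (𝓡 (n i)) (x₀ i) p) :=
      (InfBending.contDiffAt_comp_extChartAt_symm (hf i).smooth (x₀ i)
        (hεt i hp.2)).differentiableAt (by simp)
    have hFeq : f i =ᶠ[nhds p] (f i ∘ (extChartAt (𝓡 (n i)) (x₀ i)).symm)
        ∘ extChartAt (𝓡 (n i)) (x₀ i) := by
      filter_upwards [extChartAt_source_mem_nhds' hp.1] with q hq
      exact congrArg (f i) ((extChartAt (𝓡 (n i)) (x₀ i)).left_inv hq).symm
    simp only [InfBending.diff_eq_fderiv_comp hp.1 hSd Filter.EventuallyEq.rfl,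
      InfBending.diff_eq_fderiv_comp hp.1 hFd hFeq]
    exact hSb i _ hp.2 _ _
  · have h := hTD (extChartAt (InfBending.prodModel n) x₀ x) fun i _ => (hx i trivial).2
    have hxs : (extChartAt (InfBending.prodModel n) x₀).symm
        (extChartAt (InfBending.prodModel n) x₀ x) = x := by
      refine (extChartAt (InfBending.prodModel n) x₀).left_inv ?_
      rw [InfBending.extChartAt_prodModel_source]
      exact fun i _ => (hx i trivial).1
    have hfx : (WithLp.toLp 2 fun i => (f i ∘ (extChartAt (𝓡 (n i)) (x₀ i)).symm)
        (extChartAt (InfBending.prodModel n) x₀ x i) : InfBending.Ambient m)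
          = InfBending.extrinsicProduct f x := congrArg (InfBending.extrinsicProduct f) hxs
    rw [Function.comp_apply, hxs, hfx] at h
    exact h
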